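/- All graphs are finite, simple and undirected. **Tests.** For $k\ge 2$, $k$-WL colours the $k$-tuples of vertices of a graph: the initial colour of a tuple $x$ is its isomorphism type (which entries are equal, which are adjacent), and in each round the colour of $x$ is replaced by the pair consisting of the old colour of $x$ and the family, indexed by the positions $i=1,\dots,k$, of the multisets of old colours of the tuples obtained from $x$ by replacing the $i$-th entry by an arbitrary vertex $w$. Two graphs are distinguished by $k$-WL if after some round the multisets of colours of their $k$-tuples differ. For a vertex $v$ of a graph $G$, let $\mathcal N_t(v)$ be the set of vertices at distance at most $t$ from $v$; the $t$-hop egonet of $v$ is the induced subgraph $G[\mathcal N_t(v)]$, rooted at $v$. Subgraph-1-WL with $t$-hop egonets gives all vertices the same initial colour and then, in each round, replaces the colour of every $v$ by $\mathrm{HASH}$ of the $t$-hop egonet of $v$, whose vertices carry their current colours; here $\mathrm{HASH}$ is a function on rooted vertex-coloured graphs that takes equal values on isomorphic ones (it is injective if it takes equal values only on isomorphic ones). Two graphs are distinguished if after some round the multisets of their vertex colours differ. **Construction.** A separator of a graph $G=(V,E)$ is a set $S\subseteq V$ such that no connected component of $G-S$ has more than $|V|/2$ vertices; the separator size of $G$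 is the smallest size of a separator. For a set $T\subseteq E$, the Cai–Fürer–Immerman graph $X_T(G)$ has, for every $v\in V$ and every neighbour $w$ of $v$, two vertices $a_{v,w}$ and $b_{v,w}$, and, for every $v\in V$ and every set $S$ of neighbours of $v$ of even size, a vertex $m_{v,S}$. The vertex $m_{v,S}$ is adjacent to $a_{v,w}$ if $w\in S$ and to $b_{v,w}$ if $w\notin S$; for every edge $\{v,w\}\notin T$, $a_{v,w}$ is adjacent to $a_{w,v}$ and $b_{v,w}$ to $b_{w,v}$; for every edge $\{v,w\}\in T$, $a_{v,w}$ is adjacent to $b_{w,v}$ and $b_{v,w}$ to $a_{w,v}$; there are no other edges. **Theorem.** For every $k\ge 3$ there are a connected cubic graph $G$ of separator size $k+1$ and an edge $\{u,v\}$ of $G$ such that the graphs $A=X_\emptyset(G)$ and $B=X_{\{\{u,v\}\}}(G)$, which have the same vertex set, satisfy: 1. $A$ and $B$ are not isomorphic; 2. $k$-WL does not distinguish $A$ and $B$; 3. for every $t\le 4$ and every vertex $x$, the $t$-hop egonets of $x$ in $A$ and in $B$ are isomorphic by an isomorphism that fixes the root $x$; 4. for every $t\le 4$ and every function $\mathrm{HASH}$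 as above, injective or not, Subgraph-1-WL with $t$-hop egonets does not distinguish $A$ and $B$. -/

import Mathlib

universe u

namespace SubgraphWL

/-! ### Separators -/

section Separators

variable {V : Type} [Fintype V]

/-- A set `S` of vertices is a separator of `G` if no connected component of `G - S` contains more
than half of the vertices of `G`. -/
def IsSeparator (G : SimpleGraph V) (S : Finset V) : Prop :=
  ∀ K : (G.induce ((S : Set V)ᶜ)).ConnectedComponent, 2 * K.supp.ncard ≤ Fintype.card V

/-- `G` has separator size `s`: the smallest number of vertices of a separator of `G` is `s`. -/
def HasSeparatorSize (G : SimpleGraph V) (s : ℕ) : Prop :=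
  IsLeast {n : ℕ | ∃ S : Finset V, IsSeparator G S ∧ S.card = n} s

end Separators

/-! ### The Cai–Fürer–Immerman construction -/

section CFI

variable {V : Type}

/-- The vertices of the CFI graphs over `G`. For an edge `d = (v, w)` of `G`, directed away from
`v`, the gadget of `v` has the two end vertices `a_{v,w} = port d true` and
`b_{v,w} = port d false`; for every set `S` of neighbours of `v` of even size it has the middle
vertex `m_S = middle v S`. -/
inductive CFIVertex (G : SimpleGraph V) : Type
  | port (d : G.Dart) (c : Bool) : CFIVertex G
  | middle (v : V) (S : Finset V) (hS : ∀ w ∈ S, G.Adj v w) (heven : Even S.card) : CFIVertex G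

instance CFIVertex.instFinite [Finite V] (G : SimpleGraph V) : Finite (CFIVertex G) := by
  have : Finite G.Dart := Finite.of_injective (fun d => d.toProd) SimpleGraph.Dart.toProd_injective
  let f : CFIVertex G → (G.Dart × Bool) ⊕ (V × Finset V)
    | .port d c => Sum.inl (d, c)
    | .middle v S _ _ => Sum.inr (v, S)
  refine Finite.of_injective f ?_
  rintro (⟨d, c⟩ | ⟨v, S, _, _⟩) (⟨d', c'⟩ | ⟨v', S', _, _⟩) h <;> simp_all [f]

noncomputable instance CFIVertex.instFintype [Finite V] (G : SimpleGraph V) :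
    Fintype (CFIVertex G) :=
  Fintype.ofFinite _

/-- Adjacency in the CFI graph over `G` in which the edges in `T` are twisted. Inside the gadget of
`v`, the middle vertex `m_S` is adjacent to `a_{v,w}` for `w ∈ S` and to `b_{v,w}` for `w ∉ S`. For
an edge `{v, w}` of `G`, the end vertices are joined as `a_{v,w} a_{w,v}` and `b_{v,w} b_{w,v}` if
the edge is not twisted, and as `a_{v,w} b_{w,v}` and `b_{v,w} a_{w,v}` if it is. -/
def CFIAdj (G : SimpleGraph V) (T : Set (Sym2 V)) : CFIVertex G → CFIVertex G → Prop
  | .port d c, .port d' c' => d' = d.symm ∧ (d.edge ∈ T ↔ c ≠ c')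
  | .middle v S _ _, .port d c => d.fst = v ∧ (c = true ↔ d.snd ∈ S)
  | .port d c, .middle v S _ _ => d.fst = v ∧ (c = true ↔ d.snd ∈ S)
  | .middle _ _ _ _, .middle _ _ _ _ => False

/-- The CFI graph over `G` in which the edges in `T` are twisted. -/
def CFI (G : SimpleGraph V) (T : Set (Sym2 V)) : SimpleGraph (CFIVertex G) where
  Adj := CFIAdj G T
  symm := ⟨by
    rintro (⟨d, c⟩ | ⟨v, S, _, _⟩) (⟨d', c'⟩ | ⟨v', S', _, _⟩) h
    · obtain ⟨rfl, h⟩ := h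
      exact ⟨d.symm_symm.symm, by rw [d.edge_symm, h, ne_comm]⟩
    · exact h
    · exact h
    · exact h⟩
  loopless := ⟨by
    rintro (⟨d, c⟩ | ⟨v, S, _, _⟩) h
    · exact d.symm_ne h.1.symm
    · exact h⟩

end CFI

/-! ### The `k`-dimensional Weisfeiler–Leman test (on `k`-tuples, `k ≥ 2`) -/

section KWL

/-- The colours that `k`-WL uses after `l` rounds. -/
def WLColor (k : ℕ) : ℕ → Type
  | 0 => Fin k → Fin k → Prop × Prop
  | l + 1 => WLColor k l × (Fin k → Multiset (WLColor k l))

/-- The colour of a `k`-tuple after `l` rounds of `k`-WL. Initially it is the isomorphism type of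
the tuple; then the colour of `x` is refined by the family, over the positions `i`, of the multisets
of the colours of the tuples obtained from `x` by replacing the `i`-th entry by a vertex `w`. -/
def wlColor {V : Type} [Fintype V] (G : SimpleGraph V) (k : ℕ) :
    (l : ℕ) → (Fin k → V) → WLColor k l
  | 0 => fun x i j => (x i = x j, G.Adj (x i) (x j))
  | l + 1 => fun x =>
      (wlColor G k l x,
        fun i => (Finset.univ : Finset V).val.map fun w => wlColor G k l (Function.update x i w))

/-- `k`-WL distinguishes two graphs if, after some round, the multisets of the colours of their
`k`-tuples differ. -/
def KWLDistinguishes (k : ℕ) {V W : Type} [Fintype V] [Fintype W]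
    (G : SimpleGraph V) (H : SimpleGraph W) : Prop :=
  ∃ l : ℕ, (Finset.univ : Finset (Fin k → V)).val.map (wlColor G k l) ≠
    (Finset.univ : Finset (Fin k → W)).val.map (wlColor H k l)

end KWL

/-! ### Egonets and Subgraph-1-WL -/

section Subgraph1WL

/-- Finite rooted graphs with vertices coloured by `C`. -/
structure RootedGraph (C : Type u) where
  /-- the vertices -/
  Vert : Type
  /-- there are finitely many vertices -/
  finite : Finite Vert
  /-- the edges -/
  graph : SimpleGraph Vert
  /-- the root -/
  root : Vert
  /-- the colouring of the vertices -/
  color : Vert → C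

/-- Isomorphism of rooted coloured graphs. -/
def RootedGraph.Iso {C : Type u} (g h : RootedGraph C) : Prop :=
  ∃ e : g.graph ≃g h.graph, e g.root = h.root ∧ ∀ x, h.color (e x) = g.color x

/-- The vertices at distance at most `t` from `v`. -/
def hopNeighborhood {V : Type} (G : SimpleGraph V) (t : ℕ) (v : V) : Set V :=
  {w | ∃ p : G.Walk v w, p.length ≤ t}

/-- The `t`-hop egonet of `v`: the subgraph induced on the vertices at distance at most `t` from
`v`, rooted at `v`, with the vertex colours inherited from `c`. -/
def egonet {V : Type} [Finite V] {C : Type u} (G : SimpleGraph V) (c : V → C) (t : ℕ) (v : V) :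
    RootedGraph C where
  Vert := hopNeighborhood G t v
  finite := inferInstance
  graph := G.induce (hopNeighborhood G t v)
  root := ⟨v, SimpleGraph.Walk.nil, Nat.zero_le t⟩
  color := fun x => c x

/-- A function on finite rooted coloured graphs, i.e. a function that does not depend on the names
of the vertices. An injective one is one for which moreover `HASH g = HASH h` holds only for
isomorphic `g` and `h`. -/
def IsHash {C : Type u} (HASH : RootedGraph C → C) : Prop :=
  ∀ g h : RootedGraph C, g.Iso h → HASH g = HASH h

/-- The colour of a vertex after `l` rounds of Subgraph-1-WL with `t`-hop egonets on the graph `G`,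
all of whose vertices have the colour `c₀` initially. -/
def subgraphColor {V : Type} [Finite V] {C : Type u} (HASH : RootedGraph C → C) (c₀ : C)
    (G : SimpleGraph V) (t : ℕ) : ℕ → V → C
  | 0 => fun _ => c₀
  | l + 1 => fun v => HASH (egonet G (subgraphColor HASH c₀ G t l) t v)

/-- Subgraph-1-WL with `t`-hop egonets distinguishes two graphs if, after some round, the multisets
of the colours of their vertices differ. -/
def Subgraph1WLDistinguishes {C : Type u} (HASH : RootedGraph C → C) (c₀ : C) (t : ℕ)
    {V W : Type} [Fintype V] [Fintype W] (G : SimpleGraph V) (H : SimpleGraph W) : Prop :=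
  ∃ l : ℕ, (Finset.univ : Finset V).val.map (subgraphColor HASH c₀ G t l) ≠
    (Finset.univ : Finset W).val.map (subgraphColor HASH c₀ H t l)

end Subgraph1WL

end SubgraphWL

namespace SubgraphWL

/-! ### Flips of end vertices and the parity defect. -/

section Flips

variable {V : Type} {G : SimpleGraph V}

/-! Twisting can be simulated by exchanging `a_{v,w}` and `b_{v,w}` for suitable pairs `(v, w)`: `f
v w = 1` prescribes such a flip, and `f` realises the twists in `T` if exactly the edges in `T` are
flipped at one end only. The flips in a gadget extend to its middle vertices if their number is
even. For one twisted edge a defect, a gadget of odd parity, must remain somewhere, but it can be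
moved along any path of `G` by flipping both ends of each edge. Hence `A` and `B` look alike
wherever the defect is out of sight.

For `k`-WL, the defect is kept in the component of more than half of the vertices that is left when
the at most `k` base vertices of a tuple are deleted. Two such components meet, so the defect can
follow every replacement of an entry (`wlColor_flip`). For egonets, four steps reach middle vertices
only over the root's gadget and the neighbouring ones, and defects can be pushed out of these when
`G` is triangle-free and has no vertex of degree below two (`egonet_CFI_iso`).

Non-isomorphism has two steps. A parity count excludes homomorphisms from `A` to `B` that preserve
every fibre of `shadow` (`not_exists_hom_shadow_eq`). An arbitrary isomorphism is reduced to this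
case by an injection of the finite endomorphism monoid of `A` into itself (`isEmpty_CFI_iso`).

The base graph is a cylindrical hexagonal wall, where deleting `k` vertices spares a full row and a
full column. -/

/-- The end-vertex pair (given by a dart) or the set of middle vertices (given by a vertex of the
base graph) to which a vertex of the CFI graph belongs. -/
def CFIVertex.shadow : CFIVertex G → G.Dart ⊕ V
  | .port d _ => Sum.inl d
  | .middle v _ _ _ => Sum.inr v

/-- The vertex of the base graph to whose gadget a vertex of the CFI graph belongs. -/
def CFIVertex.base : CFIVertex G → V
  | .port d _ => d.fst
  | .middle v _ _ _ => v

theorem CFIVertex.base_eq_of_shadow_eq {z z' : CFIVertex G} (h : z.shadow = z'.shadow) :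
    z.base = z'.base := by
  cases z <;> cases z' <;> simp_all [shadow, base]

/-- `f` prescribes flips of end vertices (of `port d` whenever `f d.fst d.snd = 1`) that turn the
untwisted edges into the edges twisted by `T`. -/
structure IsTwisting (G : SimpleGraph V) (T : Set (Sym2 V)) (f : V → V → ZMod 2) : Prop where
  adj_of_ne_zero : ∀ v w, f v w ≠ 0 → G.Adj v w
  ne_iff : ∀ v w, G.Adj v w → (f v w ≠ f w v ↔ s(v, w) ∈ T)

/-- Flipping both ends of an edge does not change whether it is twisted, so symmetric changes of `f`
are free. -/
theorem IsTwisting.add {T : Set (Sym2 V)} {f g : V → V → ZMod 2} (hf : IsTwisting G T f)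
    (hg : ∀ v w, g v w ≠ 0 → G.Adj v w) (hsymm : ∀ v w, g v w = g w v) :
    IsTwisting G T (f + g) := by
  refine ⟨fun v w h => ?_, fun v w h => ?_⟩
  · by_contra hn
    have h1 : f v w = 0 := by by_contra h'; exact hn (hf.1 v w h')
    have h2 : g v w = 0 := by by_contra h'; exact hn (hg v w h')
    simp [h1, h2] at h
  · rw [← hf.2 v w h]
    simp [hsymm v w]

theorem isTwisting_single [DecidableEq V] {u v : V} (h : G.Adj u v) :
    IsTwisting G {s(u, v)} (fun a b => if a = u ∧ b = v then 1 else 0) := by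
  refine ⟨fun a b hab => ?_, fun a b hab => ?_⟩
  · split_ifs at hab with h'
    · rw [h'.1, h'.2]; exact h
    · exact absurd rfl hab
  · have hne := h.ne
    rw [Set.mem_singleton_iff, Sym2.eq_iff]
    by_cases h1 : a = u ∧ b = v
    · obtain ⟨rfl, rfl⟩ := h1
      simp [hne]
    · by_cases h2 : b = u ∧ a = v
      · obtain ⟨rfl, rfl⟩ := h2
        simp [hne]
      · rw [if_neg h1, if_neg h2]
        simp only [ne_eq, not_true_eq_false, false_iff, not_or]
        exact ⟨h1, fun h3 => h2 ⟨h3.2, h3.1⟩⟩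

variable [Fintype V]

/-- The parity of the number of flips in the gadget of `v`. -/
def parity (f : V → V → ZMod 2) (v : V) : ZMod 2 := ∑ w, f v w

theorem parity_add (f g : V → V → ZMod 2) : parity (f + g) = parity f + parity g := by
  funext v
  simp [parity, Finset.sum_add_distrib]

/-- The set of flips in the gadget of `v`. -/
def flipSet (f : V → V → ZMod 2) (v : V) : Finset V := {w | f v w ≠ 0}

theorem cast_card_flipSet (f : V → V → ZMod 2) (v : V) :
    ((flipSet f v).card : ZMod 2) = parity f v := by
  rw [parity, flipSet, Finset.card_filter, Nat.cast_sum]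
  refine Finset.sum_congr rfl fun w _ => ?_
  have : ∀ a : ZMod 2, ((if a ≠ 0 then 1 else 0 : ℕ) : ZMod 2) = a := by decide
  exact this _

theorem even_card_flipSet_iff (f : V → V → ZMod 2) (v : V) :
    Even (flipSet f v).card ↔ parity f v = 0 := by
  rw [← cast_card_flipSet, ZMod.natCast_eq_zero_iff_even]

variable [DecidableEq V]

theorem even_card_symmDiff {α : Type*} [DecidableEq α] {S S' : Finset α} (h : Even S.card)
    (h' : Even S'.card) : Even (symmDiff S S').card := by
  have h1 := Finset.card_sdiff_add_card_inter S S'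
  have h2 := Finset.card_sdiff_add_card_inter S' S
  have h3 : (symmDiff S S').card = (S \ S').card + (S' \ S).card :=
    Finset.card_union_of_disjoint disjoint_sdiff_sdiff
  rw [Finset.inter_comm S' S] at h2
  rw [Nat.even_iff] at *
  omega

open Classical in
/-- The action on the CFI vertices of the flips prescribed by `f`; the middle vertices of a gadget
with an odd number of flips are left alone. -/
noncomputable def flip (f : V → V → ZMod 2) : CFIVertex G → CFIVertex G
  | .port d c => .port d (if f d.fst d.snd = 0 then c else !c)
  | .middle v S hS he =>
    if h : (∀ w, f v w ≠ 0 → G.Adj v w) ∧ Even (flipSet f v).card then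
      .middle v (symmDiff S (flipSet f v))
        (fun w hw => by
          rcases Finset.mem_symmDiff.1 hw with h1 | h1
          · exact hS w h1.1
          · exact h.1 w (by simpa [flipSet] using h1.1))
        (even_card_symmDiff he h.2)
    else .middle v S hS he

theorem shadow_flip (f : V → V → ZMod 2) (z : CFIVertex G) : (flip f z).shadow = z.shadow := by
  rcases z with ⟨d, c⟩ | ⟨v, S, hS, he⟩
  · rfl
  · rw [flip]
    split_ifs <;> rfl

theorem base_flip (f : V → V → ZMod 2) (z : CFIVertex G) : (flip f z).base = z.base :=
  CFIVertex.base_eq_of_shadow_eq (shadow_flip f z)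

theorem flip_middle_of_even {f : V → V → ZMod 2} {v : V} {S : Finset V}
    (hS : ∀ w ∈ S, G.Adj v w) (he : Even S.card)
    (h : (∀ w, f v w ≠ 0 → G.Adj v w) ∧ Even (flipSet f v).card) :
    ∃ hS' he', flip f (.middle v S hS he) =
      (.middle v (symmDiff S (flipSet f v)) hS' he' : CFIVertex G) := by
  rw [flip, dif_pos h]
  exact ⟨_, _, rfl⟩

theorem flip_flip (f : V → V → ZMod 2) (z : CFIVertex G) : flip f (flip f z) = z := by
  rcases z with ⟨d, c⟩ | ⟨v, S, hS, he⟩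
  · simp only [flip]
    split_ifs <;> simp
  · by_cases h : (∀ w, f v w ≠ 0 → G.Adj v w) ∧ Even (flipSet f v).card
    · obtain ⟨hS1, he1, h1⟩ := flip_middle_of_even hS he h
      obtain ⟨hS2, he2, h2⟩ := flip_middle_of_even hS1 he1 h
      rw [h1, h2]
      congr 1
      simp
    · have h1 : flip f (.middle v S hS he) = (.middle v S hS he : CFIVertex G) := by
        rw [flip, dif_neg h]
      rw [h1, h1]

theorem flip_injective (f : V → V → ZMod 2) :
    Function.Injective (flip f : CFIVertex G → CFIVertex G) :=
  Function.LeftInverse.injective (flip_flip f)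

/-- Flips act gadget by gadget: the image of a vertex is unaffected when the defect is moved without
touching its gadget. -/
theorem flip_congr {f g : V → V → ZMod 2} {z : CFIVertex G} (h : f z.base = g z.base) :
    flip f z = flip g z := by
  rcases z with ⟨d, c⟩ | ⟨v, S, hS, he⟩
  · simp only [CFIVertex.base] at h
    simp only [flip, h]
  · simp only [CFIVertex.base] at h
    have h' : flipSet f v = flipSet g v := by simp only [flipSet, h]
    by_cases he' : (∀ w, f v w ≠ 0 → G.Adj v w) ∧ Even (flipSet f v).card
    · obtain ⟨_, _, h1⟩ := flip_middle_of_even hS he he'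
      obtain ⟨_, _, h2⟩ := flip_middle_of_even (f := g) hS he (by rw [← h, ← h']; exact he')
      rw [h1, h2]
      congr 1
      rw [h']
    · rw [flip, dif_neg he', flip, dif_neg (by rw [← h, ← h']; exact he')]

theorem flip_middle {T : Set (Sym2 V)} {f : V → V → ZMod 2} (hf : IsTwisting G T f) {v : V}
    {S : Finset V} (hS : ∀ w ∈ S, G.Adj v w) (he : Even S.card) (hv : parity f v = 0) :
    ∃ hS' he', flip f (.middle v S hS he) =
      (.middle v (symmDiff S (flipSet f v)) hS' he' : CFIVertex G) :=
  flip_middle_of_even hS he ⟨hf.1 v, (even_card_flipSet_iff f v).2 hv⟩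

theorem flip_adj_port_port {T : Set (Sym2 V)} {f : V → V → ZMod 2} (hf : IsTwisting G T f)
    (d d' : G.Dart) (c c' : Bool) :
    (CFI G T).Adj (flip f (.port d c)) (flip f (.port d' c')) ↔
      (CFI G ∅).Adj (.port d c) (.port d' c') := by
  simp only [flip, CFI, CFIAdj, Set.mem_empty_iff_false]
  refine and_congr_right fun hd => ?_
  subst hd
  have h := hf.2 d.fst d.snd d.adj
  have he : d.edge = s(d.fst, d.snd) := rfl
  rw [he, ← h]
  simp only [SimpleGraph.Dart.symm_toProd, Prod.fst_swap, Prod.snd_swap]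
  generalize f d.fst d.snd = a
  generalize f d.snd d.fst = b
  revert a b c c'
  decide

theorem flip_adj_middle_port {T : Set (Sym2 V)} {f : V → V → ZMod 2} (hf : IsTwisting G T f)
    {v : V} {S : Finset V} (hS : ∀ w ∈ S, G.Adj v w) (he : Even S.card) (hv : parity f v = 0)
    (d : G.Dart) (c : Bool) :
    (CFI G T).Adj (flip f (.middle v S hS he)) (flip f (.port d c)) ↔
      (CFI G ∅).Adj (.middle v S hS he) (.port d c) := by
  obtain ⟨hS', he', h⟩ := flip_middle hf hS he hv
  rw [h]
  simp only [flip, CFI, CFIAdj]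
  refine and_congr_right fun hd => ?_
  subst hd
  rw [Finset.mem_symmDiff]
  simp only [flipSet, Finset.mem_filter, Finset.mem_univ, true_and]
  by_cases h1 : f d.fst d.snd = 0 <;> by_cases h2 : d.snd ∈ S <;> cases c <;> simp [h1, h2]

/-- Only middle vertices over a gadget of odd parity can obstruct; this makes `flip f` a local
isomorphism away from the defect. -/
theorem flip_adj {T : Set (Sym2 V)} {f : V → V → ZMod 2} (hf : IsTwisting G T f)
    {z z' : CFIVertex G} (hz : ∀ v, z.shadow = Sum.inr v → parity f v = 0)
    (hz' : ∀ v, z'.shadow = Sum.inr v → parity f v = 0) :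
    (CFI G T).Adj (flip f z) (flip f z') ↔ (CFI G ∅).Adj z z' := by
  rcases z with ⟨d, c⟩ | ⟨v, S, hS, he⟩ <;> rcases z' with ⟨d', c'⟩ | ⟨v', S', hS', he'⟩
  · exact flip_adj_port_port hf d d' c c'
  · rw [(CFI G T).adj_comm, (CFI G ∅).adj_comm]
    exact flip_adj_middle_port hf hS' he' (hz' v' rfl) d c
  · exact flip_adj_middle_port hf hS he (hz v rfl) d' c'
  · refine iff_of_false (fun h => ?_) (fun h => h)
    obtain ⟨_, _, h1⟩ := flip_middle hf hS he (hz v rfl)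
    obtain ⟨_, _, h2⟩ := flip_middle hf hS' he' (hz' v' rfl)
    rw [h1, h2] at h
    exact h

end Flips

/-! ### Indistinguishability by `k`-WL. -/

section KWLIndistinguishable

theorem map_univ_val_eq_of_injective {α γ : Type*} [Fintype α] {σ : α → α}
    (hσ : Function.Injective σ) {g g' : α → γ} (h : ∀ a, g a = g' (σ a)) :
    (Finset.univ : Finset α).val.map g = (Finset.univ : Finset α).val.map g' := by
  let e : α ≃ α := Equiv.ofBijective σ (Finite.injective_iff_bijective.1 hσ)
  have h1 : (Finset.univ : Finset α).val.map e = (Finset.univ : Finset α).val :=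
    Multiset.map_univ_val_equiv e
  conv_rhs => rw [← h1, Multiset.map_map]
  exact Multiset.map_congr rfl fun a _ => h a

variable {V : Type} [Fintype V] {G : SimpleGraph V} {T : Set (Sym2 V)}

/-- The vertices of a component of `G - S` with more than half of the vertices of `G`. -/
def IsInLargeComponent (G : SimpleGraph V) (S : Finset V) (q : V) : Prop :=
  ∃ K : (G.induce ((S : Set V)ᶜ)).ConnectedComponent,
    Fintype.card V < 2 * K.supp.ncard ∧ q ∈ Subtype.val '' K.supp

theorem exists_isInLargeComponent {S : Finset V} (hS : ¬ IsSeparator G S) :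
    ∃ q, IsInLargeComponent G S q := by
  simp only [IsSeparator, not_forall, not_le] at hS
  obtain ⟨K, hK⟩ := hS
  obtain ⟨a, ha⟩ := K.nonempty_supp
  exact ⟨a.1, K, hK, a, ha, rfl⟩

theorem IsInLargeComponent.notMem {S : Finset V} {q : V} (h : IsInLargeComponent G S q) :
    q ∉ S := by
  obtain ⟨K, -, a, -, rfl⟩ := h
  exact a.2

/-- Two sets with more than half of the vertices each intersect; a common vertex `c` joins `q` to
`q'` by a path avoiding `S` followed by one avoiding `S'`. -/
theorem exists_mem_of_isInLargeComponent {S S' : Finset V} {q q' : V}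
    (h : IsInLargeComponent G S q) (h' : IsInLargeComponent G S' q') :
    ∃ c, ∃ (hq : q ∈ ((S : Set V)ᶜ)) (hc : c ∈ ((S : Set V)ᶜ)) (hc' : c ∈ ((S' : Set V)ᶜ))
      (hq' : q' ∈ ((S' : Set V)ᶜ)), (G.induce ((S : Set V)ᶜ)).Reachable ⟨q, hq⟩ ⟨c, hc⟩ ∧
        (G.induce ((S' : Set V)ᶜ)).Reachable ⟨c, hc'⟩ ⟨q', hq'⟩ := by
  obtain ⟨K, hK, a, ha, rfl⟩ := h
  obtain ⟨K', hK', a', ha', rfl⟩ := h'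
  have hinter : ((Subtype.val '' K.supp) ∩ (Subtype.val '' K'.supp)).Nonempty := by
    by_contra hn
    rw [Set.not_nonempty_iff_eq_empty, ← Set.disjoint_iff_inter_eq_empty] at hn
    have h1 := Set.ncard_union_eq hn (Set.toFinite _) (Set.toFinite _)
    rw [Set.ncard_image_of_injective _ Subtype.val_injective,
      Set.ncard_image_of_injective _ Subtype.val_injective] at h1
    have h2 := Set.ncard_le_card ((Subtype.val '' K.supp) ∪ (Subtype.val '' K'.supp))
    rw [Nat.card_eq_fintype_card] at h2
    omega
  obtain ⟨_, ⟨c, hc, rfl⟩, c', hc', hcc'⟩ := hinter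
  refine ⟨c.1, a.2, c.2, hcc' ▸ c'.2, a'.2, ?_, ?_⟩
  · exact SimpleGraph.ConnectedComponent.exact (ha.trans hc.symm)
  · have : (⟨c.1, hcc' ▸ c'.2⟩ : ↥((S' : Set V)ᶜ)) = c' := Subtype.ext hcc'.symm
    rw [this]
    exact SimpleGraph.ConnectedComponent.exact (hc'.trans ha'.symm)

variable [DecidableEq V]

theorem IsTwisting.exists_shift {S : Set V} {a b : ↥(Sᶜ)} (p : (G.induce Sᶜ).Walk a b) :
    ∀ {f : V → V → ZMod 2}, IsTwisting G T f → parity f = Pi.single a.1 1 →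
      ∃ f', IsTwisting G T f' ∧ parity f' = Pi.single b.1 1 ∧ ∀ v ∈ S, f' v = f v := by
  induction p with
  | nil => exact fun hf h => ⟨_, hf, h, fun _ _ => rfl⟩
  | @cons a b c hab _ ih =>
    intro f hf h
    have hab : G.Adj a.1 b.1 := hab
    have hne := hab.ne
    -- Both ends of the edge `ab` are flipped: the parities of `a` and `b` change, and all other
    -- gadgets, in particular those in `S`, stay as they are.
    let g : V → V → ZMod 2 := fun v w =>
      if v = a.1 then (if w = b.1 then 1 else 0) else
        if v = b.1 then (if w = a.1 then 1 else 0) else 0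
    have hg : ∀ v w, g v w ≠ 0 → G.Adj v w := by
      intro v w hvw
      simp only [g] at hvw
      split_ifs at hvw with h1 h2 h3 h4
      · rw [h1, h2]; exact hab
      · exact absurd rfl hvw
      · rw [h3, h4]; exact hab.symm
      · exact absurd rfl hvw
      · exact absurd rfl hvw
    have hsymm : ∀ v w, g v w = g w v := by
      intro v w
      simp only [g]
      split_ifs <;> simp_all
    have hpar : parity (f + g) = Pi.single b.1 1 := by
      rw [parity_add, h]
      funext v
      simp only [Pi.add_apply, parity, g]
      by_cases h1 : v = a.1
      · subst h1
        simp [hne]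
        decide
      · by_cases h2 : v = b.1
        · subst h2
          simp [h1]
        · simp [h1, h2]
    obtain ⟨f', hf', hp', hS⟩ := ih (hf.add hg hsymm) hpar
    refine ⟨f', hf', hp', fun v hv => ?_⟩
    rw [hS v hv]
    have h1 : v ≠ a.1 := fun h => a.2 (h ▸ hv)
    have h2 : v ≠ b.1 := fun h => b.2 (h ▸ hv)
    funext w
    simp [g, h1, h2]

theorem IsTwisting.exists_shift_largeComponent {S S' : Finset V} (hS' : ¬ IsSeparator G S')
    {f : V → V → ZMod 2} {q : V} (hf : IsTwisting G T f) (hp : parity f = Pi.single q 1)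
    (hq : IsInLargeComponent G S q) :
    ∃ f' q', IsTwisting G T f' ∧ parity f' = Pi.single q' 1 ∧ IsInLargeComponent G S' q' ∧
      ∀ v ∈ S, v ∈ S' → f' v = f v := by
  obtain ⟨q', hq'⟩ := exists_isInLargeComponent hS'
  obtain ⟨c, h1, h2, h3, h4, ⟨w1⟩, ⟨w2⟩⟩ := exists_mem_of_isInLargeComponent hq hq'
  obtain ⟨f1, hf1, hp1, hs1⟩ := IsTwisting.exists_shift w1 hf hp
  obtain ⟨f2, hf2, hp2, hs2⟩ := IsTwisting.exists_shift w2 hf1 hp1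
  exact ⟨f2, q', hf2, hp2, hq', fun v hv hv' => (hs2 v hv').trans (hs1 v hv)⟩

/-- Invariant of a strategy in the bijective pebble game: the defect sits in the large component
that avoids all gadgets of the tuple. -/
theorem wlColor_flip {k : ℕ} (hG : ∀ S : Finset V, S.card ≤ k → ¬ IsSeparator G S) (l : ℕ) :
    ∀ (x : Fin k → CFIVertex G) {f : V → V → ZMod 2} {q : V}, IsTwisting G T f →
      parity f = Pi.single q 1 →
      IsInLargeComponent G (Finset.univ.image fun i => (x i).base) q →
      wlColor (CFI G ∅) k l x = wlColor (CFI G T) k l (fun i => flip f (x i)) := by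
  induction l with
  | zero =>
    intro x f q hf hp hq
    have hev : ∀ i v, (x i).shadow = Sum.inr v → parity f v = 0 := by
      intro i v hv
      have hb : (x i).base = v := by
        cases h : x i <;> simp_all [CFIVertex.shadow, CFIVertex.base]
      rw [hp, Pi.single_apply, if_neg]
      rintro rfl
      exact hq.notMem (Finset.mem_image.2 ⟨i, Finset.mem_univ _, hb⟩)
    funext i j
    simp only [wlColor, (flip_injective f).eq_iff]
    rw [flip_adj hf (hev i) (hev j)]
  | succ l ih =>
    intro x f q hf hp hq
    simp only [wlColor]
    rw [← ih x hf hp hq]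
    congr 1
    funext i
    have hex : ∀ r : V, ∃ f', (∃ q', IsTwisting G T f' ∧ parity f' = Pi.single q' 1 ∧
        IsInLargeComponent G
          (Finset.univ.image (Function.update (fun j => (x j).base) i r)) q') ∧
        ∀ j, j ≠ i → f' (x j).base = f (x j).base := by
      intro r
      obtain ⟨f', q', hf', hp', hq', h⟩ := hf.exists_shift_largeComponent
        (S' := Finset.univ.image (Function.update (fun j => (x j).base) i r))
        (hG _ (Finset.card_image_le.trans (by simp))) hp hq
      refine ⟨f', ⟨q', hf', hp', hq'⟩, fun j hj => h _ ?_ ?_⟩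
      · exact Finset.mem_image.2 ⟨j, Finset.mem_univ _, rfl⟩
      · exact Finset.mem_image.2 ⟨j, Finset.mem_univ _, by simp [hj]⟩
    choose F hF hFf using hex
    -- The flips depend on `w` only through its gadget, and flips preserve gadgets, so gluing them
    -- yields an injective map.
    refine map_univ_val_eq_of_injective (σ := fun w => flip (F w.base) w) ?_ ?_
    · intro w w' h
      have hb : w.base = w'.base := by
        have := congrArg CFIVertex.base h
        simpa only [base_flip] using this
      simp only [hb] at h
      exact flip_injective _ h
    · intro w
      obtain ⟨q', hf', hp', hq'⟩ := hF w.base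
      have hbase : (fun j => (Function.update x i w j).base) =
          Function.update (fun j => (x j).base) i w.base := by
        funext j
        by_cases hj : j = i
        · subst hj; simp
        · simp [hj]
      rw [ih (Function.update x i w) hf' hp' (by rw [hbase]; exact hq')]
      congr 1
      funext j
      by_cases hj : j = i
      · subst hj; simp
      · simp only [ne_eq, hj, not_false_eq_true, Function.update_of_ne]
        exact flip_congr (hFf w.base j hj)

theorem not_kWLDistinguishes_CFI {k : ℕ} (hG : ∀ S : Finset V, S.card ≤ k → ¬ IsSeparator G S)
    (hconn : G.Connected) {u v : V} (huv : G.Adj u v) :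
    ¬ KWLDistinguishes k (CFI G ∅) (CFI G {s(u, v)}) := by
  rintro ⟨l, hl⟩
  apply hl
  have hex : ∀ b : Fin k → V, ∃ f q, IsTwisting G {s(u, v)} f ∧ parity f = Pi.single q 1 ∧
      IsInLargeComponent G (Finset.univ.image b) q := by
    intro b
    obtain ⟨q, hq⟩ := exists_isInLargeComponent
      (hG (Finset.univ.image b) (Finset.card_image_le.trans (by simp)))
    have hp : parity (fun a b => if a = u ∧ b = v then 1 else 0) = Pi.single u 1 := by
      funext a
      by_cases h : a = u
      · subst h; simp [parity]
      · simp [parity, h]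
    -- No vertex has to be avoided yet: the defect is taken from `u` to `q` by connectedness alone.
    have hreach : (G.induce ((∅ : Set V)ᶜ)).Reachable ⟨u, by simp⟩ ⟨q, by simp⟩ := by
      obtain ⟨w⟩ := hconn u q
      exact ⟨w.induce _ (by simp)⟩
    obtain ⟨w⟩ := hreach
    obtain ⟨f, hf, hpf, -⟩ := (isTwisting_single huv).exists_shift w hp
    exact ⟨f, q, hf, hpf, hq⟩
  choose F Q hF hP hQ using hex
  refine map_univ_val_eq_of_injective
    (σ := fun x i => flip (F fun j => (x j).base) (x i)) ?_ ?_
  · intro x x' h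
    have hb : (fun j => (x j).base) = fun j => (x' j).base := by
      funext j
      have := congrArg CFIVertex.base (congrFun h j)
      simpa only [base_flip] using this
    funext j
    have := congrFun h j
    simp only [hb] at this
    exact flip_injective _ this
  · intro x
    exact wlColor_flip hG l x (hF _) (hP _) (hQ _)

end KWLIndistinguishable

/-! ### Egonets and Subgraph-1-WL. -/

section Egonets

variable {V : Type} {G : SimpleGraph V} {T : Set (Sym2 V)}

open Classical in
/-- A lower bound for the distance of a CFI vertex from the gadget of `r`, capped at `5`. -/
noncomputable def level (r : V) : CFIVertex G → ℕ
  | .port d _ =>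
    if d.fst = r then 0 else
      if G.Adj r d.fst then (if d.snd = r then 1 else 3) else if G.Adj r d.snd then 4 else 5
  | .middle v _ _ _ => if v = r then 0 else if G.Adj r v then 2 else 5

theorem level_base (z : CFIVertex G) : level z.base z = 0 := by
  cases z <;> simp [level, CFIVertex.base]

theorem level_congr {r : V} {z z' : CFIVertex G} (h : z.shadow = z'.shadow) :
    level r z = level r z' := by
  cases z <;> cases z' <;>
    simp only [CFIVertex.shadow, Sum.inl.injEq, Sum.inr.injEq, reduceCtorEq] at h <;>
    subst h <;> rfl

theorem level_le_of_adj (r : V) {z z' : CFIVertex G} (h : (CFI G T).Adj z z') :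
    level r z' ≤ level r z + 1 := by
  rcases z with ⟨d, c⟩ | ⟨v, S, hS, he⟩ <;> rcases z' with ⟨d', c'⟩ | ⟨v', S', hS', he'⟩
  · obtain ⟨rfl, -⟩ := h
    have hd := d.adj
    have hne := d.adj.ne
    simp only [level, SimpleGraph.Dart.symm_toProd, Prod.fst_swap, Prod.snd_swap]
    by_cases h1 : d.fst = r
    · subst h1
      simp [hd, hne.symm]
    · by_cases h2 : d.snd = r
      · simp [h2]
      · simp only [h1, h2, if_false]
        split_ifs <;> first
          | omega
          | exact absurd ‹G.Adj r d.fst› ‹¬ G.Adj r d.symm.snd›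
  · obtain ⟨rfl, -⟩ := h
    simp only [level]
    split_ifs <;> omega
  · obtain ⟨rfl, -⟩ := h
    simp only [level]
    split_ifs <;> omega
  · exact h.elim

/-- Middle vertices of gadgets further away have level 5, which is where the bound `t ≤ 4` comes
from. -/
theorem eq_or_adj_of_level_le {r v : V} {z : CFIVertex G} (h : level r z ≤ 4)
    (hz : z.shadow = Sum.inr v) : v = r ∨ G.Adj r v := by
  rcases z with ⟨d, c⟩ | ⟨v', S, hS, he⟩
  · simp [CFIVertex.shadow] at hz
  · simp only [CFIVertex.shadow, Sum.inr.injEq] at hz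
    subst hz
    simp only [level] at h
    split_ifs at h with h1 h2
    · exact Or.inl h1
    · exact Or.inr h2
    · omega

/-- Distances are measured in the whole graph, but a walk this short never leaves the region where
`φ` preserves adjacency. -/
theorem exists_walk_map_of_level {W : Type} {H H' : SimpleGraph W} {φ : W → W} {ℓ : W → ℕ}
    {m : ℕ} (hℓ : ∀ z z', H.Adj z z' → ℓ z' ≤ ℓ z + 1)
    (hφ : ∀ z z', ℓ z ≤ m → ℓ z' ≤ m → H.Adj z z' → H'.Adj (φ z) (φ z')) {z z' : W}
    (p : H.Walk z z') (hp : ℓ z + p.length ≤ m) :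
    ℓ z' ≤ m ∧ ∃ q : H'.Walk (φ z) (φ z'), q.length = p.length := by
  induction p with
  | nil => exact ⟨by simpa using hp, SimpleGraph.Walk.nil, rfl⟩
  | @cons a b c hab p ih =>
    rw [SimpleGraph.Walk.length_cons] at hp
    have h1 := hℓ _ _ hab
    obtain ⟨h2, q, hq⟩ := ih (by omega)
    exact ⟨h2, SimpleGraph.Walk.cons (hφ _ _ (by omega) (by omega) hab) q, by simp [hq]⟩

variable [Fintype V] [DecidableEq V]

theorem egonet_iso_of_flip {C : Type*} {t : ℕ} (ht : t ≤ 4) {f : V → V → ZMod 2}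
    (hf : IsTwisting G T f) (z : CFIVertex G)
    (heven : ∀ v, v = z.base ∨ G.Adj z.base v → parity f v = 0) {c c' : CFIVertex G → C}
    (hc : ∀ y, c' (flip f y) = c y) :
    (egonet (CFI G ∅) c t z).Iso (egonet (CFI G T) c' t (flip f z)) := by
  have hpar : ∀ y : CFIVertex G, level z.base y ≤ 4 →
      ∀ v, y.shadow = Sum.inr v → parity f v = 0 :=
    fun y hy v hv => heven v (eq_or_adj_of_level_le hy hv)
  have hadj : ∀ y y' : CFIVertex G, level z.base y ≤ 4 → level z.base y' ≤ 4 →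
      ((CFI G T).Adj (flip f y) (flip f y') ↔ (CFI G ∅).Adj y y') :=
    fun y y' hy hy' => flip_adj hf (hpar y hy) (hpar y' hy')
  have hto : ∀ y ∈ hopNeighborhood (CFI G ∅) t z,
      level z.base y ≤ 4 ∧ flip f y ∈ hopNeighborhood (CFI G T) t (flip f z) := by
    rintro y ⟨p, hp⟩
    obtain ⟨h1, q, hq⟩ := exists_walk_map_of_level (H' := CFI G T) (φ := flip f)
      (ℓ := level z.base) (m := 4) (fun _ _ => level_le_of_adj _)
      (fun y y' hy hy' => (hadj y y' hy hy').2) p (by rw [level_base]; omega)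
    exact ⟨h1, q, hq ▸ hp⟩
  have hinv : ∀ y ∈ hopNeighborhood (CFI G T) t (flip f z),
      flip f y ∈ hopNeighborhood (CFI G ∅) t z := by
    rintro y ⟨p, hp⟩
    obtain ⟨-, q, hq⟩ := exists_walk_map_of_level (H' := CFI G ∅) (φ := flip f)
      (ℓ := level z.base) (m := 4) (fun _ _ => level_le_of_adj _)
      (fun y y' hy hy' h => by
        refine (hadj _ _ ?_ ?_).1 (by rwa [flip_flip, flip_flip]) <;>
        rwa [level_congr (shadow_flip f _)])
      p (by rw [level_congr (shadow_flip f _), level_base]; omega)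
    exact ⟨q.copy (flip_flip f z) rfl, by rw [SimpleGraph.Walk.length_copy]; exact hq ▸ hp⟩
  refine ⟨⟨⟨fun y => ⟨flip f y.1, (hto y.1 y.2).2⟩, fun y => ⟨flip f y.1, hinv y.1 y.2⟩, ?_, ?_⟩,
    ?_⟩, ?_, ?_⟩
  · exact fun y => Subtype.ext (flip_flip f y.1)
  · exact fun y => Subtype.ext (flip_flip f y.1)
  · intro y y'
    exact hadj y.1 y'.1 (hto y.1 y.2).1 (hto y'.1 y'.2).1
  · rfl
  · exact fun y => hc y.1

/-- The flips at `r` can be prescribed. Each neighbour of `r` then passes its defect on to a further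
neighbour, which is not adjacent to `r` because there are no triangles, so these corrections do not
interfere. -/
theorem IsTwisting.exists_even_near {f : V → V → ZMod 2} (hf : IsTwisting G T f)
    (hdeg : ∀ v w, ∃ n, G.Adj v n ∧ n ≠ w) (htri : ∀ a b c, G.Adj a b → G.Adj b c → ¬ G.Adj a c)
    (r : V) {g : V → ZMod 2} (hg : ∀ w, g w ≠ 0 → G.Adj r w) (hg0 : ∑ w, g w = 0) :
    ∃ f', IsTwisting G T f' ∧ f' r = g ∧ ∀ v, v = r ∨ G.Adj r v → parity f' v = 0 := by
  -- Symmetric correction on the edges at `r` that turns the row `f r` into `g`.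
  let s : V → V → ZMod 2 := fun v w =>
    if v = r then f r w + g w else if w = r then f r v + g v else 0
  have hs0 : ∀ w, f r w + g w ≠ 0 → G.Adj r w := by
    intro w hw
    by_contra h
    have h1 : f r w = 0 := by by_contra h'; exact h (hf.1 r w h')
    have h2 : g w = 0 := by by_contra h'; exact h (hg w h')
    exact hw (by rw [h1, h2, add_zero])
  have hs : ∀ v w, s v w ≠ 0 → G.Adj v w := by
    intro v w h
    simp only [s] at h
    split_ifs at h with h1 h2
    · rw [h1]; exact hs0 w h
    · rw [h2]; exact (hs0 v h).symm
    · exact absurd rfl h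
  have hssymm : ∀ v w, s v w = s w v := by
    intro v w
    simp only [s]
    split_ifs <;> simp_all
  have hf1 := hf.add hs hssymm
  have hf1r : (f + s) r = g := by
    funext w
    simp only [Pi.add_apply, s, if_true]
    rw [← add_assoc, CharTwo.add_self_eq_zero, zero_add]
  generalize f + s = f1 at hf1 hf1r
  choose n hn hnr using fun v => hdeg v r
  classical
  let p : V → V → ZMod 2 := fun v w => if G.Adj r v ∧ w = n v then parity f1 v else 0
  have hp : ∀ v w, p v w + p w v ≠ 0 → G.Adj v w := by
    intro v w h
    by_contra hvw
    apply h
    have h1 : p v w = 0 := if_neg fun h' : G.Adj r v ∧ w = n v => hvw (h'.2 ▸ hn v)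
    have h2 : p w v = 0 := if_neg fun h' : G.Adj r w ∧ v = n w => hvw (h'.2 ▸ (hn w).symm)
    rw [h1, h2, add_zero]
  have hpr : ∀ w, p r w + p w r = 0 := by
    intro w
    have h1 : p r w = 0 := if_neg fun h' => h'.1.ne rfl
    have h2 : p w r = 0 := if_neg fun h' => hnr w h'.2.symm
    rw [h1, h2, add_zero]
  refine ⟨f1 + fun v w => p v w + p w v, hf1.add hp fun v w => add_comm _ _, ?_, ?_⟩
  · funext w
    simp [hf1r, hpr]
  · rintro v hv
    rw [parity_add, Pi.add_apply]
    rcases hv with rfl | hv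
    · simp [parity, hf1r, hpr, hg0]
    · have h1 : ∀ w, p w v = 0 := by
        intro w
        refine if_neg fun h => htri r w v h.1 ?_ hv
        rw [h.2]
        exact hn w
      have h2 : parity (fun v w => p v w + p w v) v = parity f1 v := by
        conv_lhs => rw [parity]
        simp only [h1, add_zero]
        simp [p, hv]
      rw [h2, CharTwo.add_self_eq_zero]

theorem exists_flip_eq_of_shadow_eq {f : V → V → ZMod 2} (hf : IsTwisting G T f)
    (hdeg : ∀ v w, ∃ n, G.Adj v n ∧ n ≠ w) (htri : ∀ a b c, G.Adj a b → G.Adj b c → ¬ G.Adj a c)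
    {z z' : CFIVertex G} (h : z.shadow = z'.shadow) :
    ∃ f', IsTwisting G T f' ∧ flip f' z = z' ∧
      ∀ v, v = z.base ∨ G.Adj z.base v → parity f' v = 0 := by
  rcases z with ⟨d, c⟩ | ⟨v, S, hS, he⟩ <;> rcases z' with ⟨d', c'⟩ | ⟨v', S', hS', he'⟩
  · simp only [CFIVertex.shadow, Sum.inl.injEq] at h
    subst h
    obtain ⟨n, hn, hne⟩ := hdeg d.fst d.snd
    -- If the end vertex has to be flipped, a second flip towards `n` keeps the parity at `d.fst`
    -- even.
    let a : ZMod 2 := if c = c' then 0 else 1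
    obtain ⟨f', hf', hr, hp⟩ := hf.exists_even_near hdeg htri d.fst
      (g := fun w => (if w = d.snd then a else 0) + (if w = n then a else 0))
      (fun w hw => by
        by_contra h
        apply hw
        rw [if_neg, if_neg, add_zero]
        · rintro rfl; exact h hn
        · rintro rfl; exact h d.adj)
      (by simp [Finset.sum_add_distrib, CharTwo.add_self_eq_zero])
    refine ⟨f', hf', ?_, hp⟩
    simp only [flip]
    congr 1
    rw [hr]
    simp only [if_true, hne.symm, if_false, add_zero, a]
    cases c <;> cases c' <;> simp
  · simp [CFIVertex.shadow] at h
  · simp [CFIVertex.shadow] at h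
  · simp only [CFIVertex.shadow, Sum.inr.injEq] at h
    subst h
    let g : V → ZMod 2 := fun w => if w ∈ symmDiff S S' then 1 else 0
    have hg : ∑ w, g w = 0 := by
      simp only [g, Finset.sum_ite_mem, Finset.univ_inter, Finset.sum_const, nsmul_eq_mul, mul_one]
      rw [ZMod.natCast_eq_zero_iff_even]
      exact even_card_symmDiff he he'
    obtain ⟨f', hf', hr, hp⟩ := hf.exists_even_near hdeg htri v (g := g)
      (fun w hw => by
        by_contra h
        apply hw
        refine if_neg fun h' => h ?_
        rcases Finset.mem_symmDiff.1 h' with h1 | h1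
        · exact hS w h1.1
        · exact hS' w h1.1) hg
    refine ⟨f', hf', ?_, hp⟩
    obtain ⟨_, _, h1⟩ := flip_middle hf' hS he (hp v (Or.inl rfl))
    have h2 : flipSet f' v = symmDiff S S' := by
      ext w
      simp [flipSet, hr, g]
    rw [h1]
    congr 1
    rw [h2, symmDiff_symmDiff_cancel_left]

theorem egonet_CFI_iso {f : V → V → ZMod 2} (hf : IsTwisting G T f)
    (hdeg : ∀ v w, ∃ n, G.Adj v n ∧ n ≠ w) (htri : ∀ a b c, G.Adj a b → G.Adj b c → ¬ G.Adj a c)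
    {C : Type*} {t : ℕ} (ht : t ≤ 4) {z z' : CFIVertex G} (h : z.shadow = z'.shadow)
    {c c' : CFIVertex G → C} (hc : ∀ y y', y.shadow = y'.shadow → c y = c' y') :
    (egonet (CFI G ∅) c t z).Iso (egonet (CFI G T) c' t z') := by
  obtain ⟨f', hf', rfl, hp⟩ := exists_flip_eq_of_shadow_eq hf hdeg htri h
  exact egonet_iso_of_flip ht hf' z hp fun y => (hc _ _ (shadow_flip f' y).symm).symm

/-- Strengthened for the induction: in every round the colour depends only on the shadow, and in the
same way in both graphs. The flips preserve shadows, hence also the colours inside the egonets. -/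
theorem subgraphColor_CFI_eq {f : V → V → ZMod 2} (hf : IsTwisting G T f)
    (hdeg : ∀ v w, ∃ n, G.Adj v n ∧ n ≠ w) (htri : ∀ a b c, G.Adj a b → G.Adj b c → ¬ G.Adj a c)
    {C : Type*} (c₀ : C) {HASH : RootedGraph C → C} (hH : IsHash HASH) {t : ℕ} (ht : t ≤ 4)
    (l : ℕ) : ∀ z z' : CFIVertex G, z.shadow = z'.shadow →
      subgraphColor HASH c₀ (CFI G ∅) t l z = subgraphColor HASH c₀ (CFI G T) t l z' := by
  induction l with
  | zero => exact fun _ _ _ => rfl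
  | succ l ih => exact fun z z' h => hH _ _ (egonet_CFI_iso hf hdeg htri ht h ih)

end Egonets

/-! ### Non-isomorphism. -/

section NotIsomorphic

variable {V : Type} {G : SimpleGraph V} {T : Set (Sym2 V)}

theorem sum_indicator_eq_zero {p q a b : Prop} [Decidable p] [Decidable q] [Decidable a]
    [Decidable b] (h : p ∨ q ↔ ¬ (a ↔ b)) (h' : ¬ (p ∧ q)) :
    ((if a then 1 else 0) + if p then 1 else 0) + ((if b then 1 else 0) + if q then 1 else 0) =
      (0 : ZMod 2) := by
  by_cases hp : p <;> by_cases hq : q <;> by_cases ha : a <;> by_cases hb : b <;>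
    simp only [hp, hq, ha, hb, if_true, if_false] at h h' ⊢ <;> first | rfl | simp at h h'

/-- The images of the vertices `m_{v,∅}` are even sets `S v`, and they determine the images of all
`b_{v,w}`. Summing the indicators of `w ∈ S v` over all pairs gives 0 gadget by gadget, but 1 edge
by edge, since only the twisted edge contributes. -/
theorem not_exists_hom_shadow_eq [Fintype V] {u v : V} (huv : G.Adj u v)
    (h : CFI G ∅ →g CFI G {s(u, v)}) : ¬ ∀ z, (h z).shadow = z.shadow := by
  classical
  intro hsh
  have hmid : ∀ a : V, ∃ S : Finset V, ∃ (hS : ∀ w ∈ S, G.Adj a w) (he : Even S.card),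
      h (.middle a ∅ (by simp) (by simp)) = .middle a S hS he := by
    intro a
    have h1 := hsh (.middle a ∅ (by simp) (by simp))
    cases h2 : h (.middle a ∅ (by simp) (by simp)) with
    | port d c => rw [h2] at h1; simp [CFIVertex.shadow] at h1
    | middle a' S hS he =>
      rw [h2] at h1
      simp only [CFIVertex.shadow, Sum.inr.injEq] at h1
      subst h1
      exact ⟨S, hS, he, rfl⟩
  choose S hS he hSeq using hmid
  have hport : ∀ d : G.Dart, h (.port d false) = .port d (decide (d.snd ∈ S d.fst)) := by
    intro d
    have h1 := hsh (.port d false)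
    cases h2 : h (.port d false) with
    | middle a' S hS he => rw [h2] at h1; simp [CFIVertex.shadow] at h1
    | port d' c =>
      rw [h2] at h1
      simp only [CFIVertex.shadow, Sum.inl.injEq] at h1
      subst h1
      have h3 : (CFI G ∅).Adj (.middle d'.fst ∅ (by simp) (by simp)) (.port d' false) :=
        ⟨rfl, by simp⟩
      have h4 := h.map_adj h3
      rw [h2, hSeq] at h4
      congr 1
      rw [Bool.eq_iff_iff, decide_eq_true_iff]
      exact h4.2
  have hedge : ∀ a b, G.Adj a b → (s(a, b) = s(u, v) ↔ ¬ (b ∈ S a ↔ a ∈ S b)) := by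
    intro a b hab
    let d : G.Dart := ⟨(a, b), hab⟩
    have h3 : (CFI G ∅).Adj (.port d false) (.port d.symm false) := ⟨rfl, by simp⟩
    have h4 := h.map_adj h3
    rw [hport, hport] at h4
    have h5 : s(a, b) ∈ ({s(u, v)} : Set (Sym2 V)) ↔
      decide (b ∈ S a) ≠ decide (a ∈ S b) := h4.2
    rw [Set.mem_singleton_iff] at h5
    rw [h5, ne_eq, decide_eq_decide]
  let y : V × V → ZMod 2 := fun p =>
    (if p.2 ∈ S p.1 then 1 else 0) + if p.1 = u ∧ p.2 = v then 1 else 0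
  have hy1 : ∀ p, y p + y p.swap = 0 := by
    rintro ⟨a, b⟩
    simp only [y, Prod.swap]
    by_cases hab : G.Adj a b
    · have h1 := hedge a b hab
      rw [Sym2.eq_iff] at h1
      have h2 : ¬ ((a = u ∧ b = v) ∧ (b = u ∧ a = v)) := by
        rintro ⟨⟨rfl, rfl⟩, h3, -⟩
        exact hab.ne h3.symm
      have hcomm : (a = v ∧ b = u) ↔ (b = u ∧ a = v) := and_comm
      rw [hcomm] at h1
      exact sum_indicator_eq_zero h1 h2
    · have e1 : b ∉ S a := fun h' => hab (hS a b h')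
      have e2 : a ∉ S b := fun h' => hab (hS b a h').symm
      have e3 : ¬ (a = u ∧ b = v) := by rintro ⟨rfl, rfl⟩; exact hab huv
      have e4 : ¬ (b = u ∧ a = v) := by rintro ⟨rfl, rfl⟩; exact hab huv.symm
      simp [e1, e2, e3, e4]
  have hy2 : ∑ p, y p = 0 := by
    refine Finset.sum_involution (fun p _ => p.swap) (fun p _ => hy1 p) ?_
      (fun _ _ => Finset.mem_univ _) (fun p _ => p.swap_swap)
    rintro ⟨a, b⟩ - hne heq
    apply hne
    simp only [Prod.swap, Prod.mk.injEq] at heq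
    obtain ⟨rfl, -⟩ := heq
    have e1 : b ∉ S b := fun h' => (hS b b h').ne rfl
    have e2 : ¬ (b = u ∧ b = v) := by rintro ⟨rfl, rfl⟩; exact huv.ne rfl
    simp [y, e1, e2]
  have hy3 : ∑ p, y p = 1 := by
    simp only [y, Finset.sum_add_distrib]
    rw [Fintype.sum_prod_type, Fintype.sum_prod_type]
    have h1 : ∀ a, (∑ b, if b ∈ S a then (1 : ZMod 2) else 0) = 0 := by
      intro a
      simp only [Finset.sum_ite_mem, Finset.univ_inter, Finset.sum_const, nsmul_eq_mul, mul_one]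
      rw [ZMod.natCast_eq_zero_iff_even]
      exact he a
    have h2 : (∑ a, ∑ b, if a = u ∧ b = v then (1 : ZMod 2) else 0) = 1 := by
      rw [Finset.sum_eq_single u (by intro b _ hb; simp [hb]) (by simp)]
      simp
    simp only [h1, h2, Finset.sum_const_zero, zero_add]
  rw [hy2] at hy3
  exact absurd hy3 (by decide)

variable [DecidableEq V]

/-- The fibrewise difference of two CFI vertices with the same shadow, where `b_{v,w}` and
`m_{v,∅}` are the zeros. -/
def CFIVertex.diff : CFIVertex G → CFIVertex G → CFIVertex G
  | .port d c, .port _ c' => .port d (xor c c')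
  | .middle v S hS he, .middle v' S' hS' he' =>
    if h : v = v' then .middle v (symmDiff S S')
      (fun w hw => by
        rcases Finset.mem_symmDiff.1 hw with h1 | h1
        · exact hS w h1.1
        · exact h ▸ hS' w h1.1)
      (even_card_symmDiff he he')
    else .middle v S hS he
  | z, _ => z

theorem CFIVertex.shadow_diff (z z' : CFIVertex G) : (z.diff z').shadow = z.shadow := by
  rcases z with ⟨d, c⟩ | ⟨v, S, hS, he⟩ <;> rcases z' with ⟨d', c'⟩ | ⟨v', S', hS', he'⟩
  · rfl
  · rfl
  · rfl
  · rw [diff]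
    split_ifs <;> rfl

theorem CFIVertex.diff_left_injective {z z' y : CFIVertex G} (hz : z.shadow = y.shadow)
    (hz' : z'.shadow = y.shadow) (h : z.diff y = z'.diff y) : z = z' := by
  rcases y with ⟨d, c⟩ | ⟨v, S, hS, he⟩ <;> rcases z with ⟨d', c'⟩ | ⟨v', S', hS', he'⟩ <;>
    rcases z' with ⟨d'', c''⟩ | ⟨v'', S'', hS'', he''⟩ <;>
    simp only [shadow, Sum.inl.injEq, Sum.inr.injEq, reduceCtorEq] at hz hz'
  · subst hz hz'
    simpa [diff] using h
  · subst hz hz'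
    simpa [diff] using h

/-- Between two fibres, adjacency is an affine condition over the field with two elements. Twisting
changes only its constant term, so differences satisfy the untwisted condition. -/
theorem CFIVertex.diff_adj {z z' y y' : CFIVertex G} (hz : z.shadow = y.shadow)
    (hz' : z'.shadow = y'.shadow) (h : (CFI G T).Adj z z') (h' : (CFI G T).Adj y y') :
    (CFI G ∅).Adj (z.diff y) (z'.diff y') := by
  rcases z with ⟨d, c⟩ | ⟨v, S, hS, he⟩ <;> rcases y with ⟨d1, c1⟩ | ⟨v1, S1, hS1, he1⟩ <;>
    simp only [shadow, Sum.inl.injEq, Sum.inr.injEq, reduceCtorEq] at hz <;>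
    rcases z' with ⟨d', c'⟩ | ⟨v', S', hS', he'⟩ <;>
    rcases y' with ⟨d1', c1'⟩ | ⟨v1', S1', hS1', he1'⟩ <;>
    simp only [shadow, Sum.inl.injEq, Sum.inr.injEq, reduceCtorEq] at hz' <;>
    subst hz hz'
  · obtain ⟨rfl, h1⟩ := h
    obtain ⟨-, h2⟩ := h'
    refine ⟨rfl, ?_⟩
    rw [h1] at h2
    clear h1
    revert h2
    simp only [Set.mem_empty_iff_false]
    revert c c' c1 c1'
    decide
  · obtain ⟨rfl, h1⟩ := h
    obtain ⟨-, h2⟩ := h'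
    rw [diff, diff, dif_pos rfl]
    refine ⟨rfl, ?_⟩
    rw [Finset.mem_symmDiff, ← h1, ← h2]
    revert c c1
    simp
  · obtain ⟨rfl, h1⟩ := h
    obtain ⟨-, h2⟩ := h'
    rw [diff, diff, dif_pos rfl]
    refine ⟨rfl, ?_⟩
    rw [Finset.mem_symmDiff, ← h1, ← h2]
    revert c' c1'
    simp
  · exact h.elim

/-- An isomorphism may permute the fibres. Homomorphisms into the twisted graph with a given shadow
map inject, by subtracting one of them, into the homomorphisms into the untwisted graph with that
shadow map. -/
theorem isEmpty_CFI_iso [Fintype V] {u v : V} (huv : G.Adj u v) :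
    IsEmpty (CFI G ∅ ≃g CFI G {s(u, v)}) := by
  refine ⟨fun θ => ?_⟩
  -- `F` chooses one representative in each class of homomorphisms with the same shadow map.
  have hchoice : ∃ F : (CFI G ∅ →g CFI G {s(u, v)}) → (CFI G ∅ →g CFI G {s(u, v)}),
      (∀ σ z, (F σ z).shadow = (σ z).shadow) ∧
      ∀ σ σ', (∀ z, (σ z).shadow = (σ' z).shadow) → F σ = F σ' := by
    let s : Setoid (CFI G ∅ →g CFI G {s(u, v)}) :=
      Setoid.comap (fun σ z => (σ z).shadow) ⊥
    refine ⟨fun σ => (Quotient.mk s σ).out, fun σ z => ?_, fun σ σ' h => ?_⟩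
    · exact congrFun (Quotient.mk_out (s := s) σ) z
    · exact congrArg Quotient.out (Quotient.sound (s := s) (funext h))
  obtain ⟨F, hF1, hF2⟩ := hchoice
  let Ξ : (CFI G ∅ →g CFI G {s(u, v)}) → (CFI G ∅ →g CFI G ∅) := fun σ =>
    ⟨fun z => (σ z).diff (F σ z), fun {a b} hab =>
      CFIVertex.diff_adj (hF1 σ a).symm (hF1 σ b).symm (σ.map_adj hab) ((F σ).map_adj hab)⟩
  have hΞ : ∀ σ z, (Ξ σ z).shadow = (σ z).shadow := fun σ z => CFIVertex.shadow_diff _ _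
  have hΞinj : Function.Injective Ξ := by
    intro σ σ' h
    have hsh : ∀ z, (σ z).shadow = (σ' z).shadow := fun z => by rw [← hΞ, ← hΞ, h]
    have hF := hF2 σ σ' hsh
    refine DFunLike.ext _ _ fun z => ?_
    have h1 : (σ z).diff (F σ z) = (σ' z).diff (F σ' z) := DFunLike.congr_fun h z
    rw [← hF] at h1
    exact CFIVertex.diff_left_injective (hF1 σ z).symm ((hsh z).symm.trans (hF1 σ z).symm) h1
  have : Finite (CFI G ∅ →g CFI G ∅) := DFunLike.finite _
  have hcomp : Function.Injective fun σ : CFI G ∅ →g CFI G ∅ => Ξ (θ.toHom.comp σ) := by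
    intro σ σ' h
    have h1 := hΞinj h
    refine DFunLike.ext _ _ fun z => ?_
    exact θ.injective (DFunLike.congr_fun h1 z)
  -- An injective self-map of a finite set hits the identity; its preimage `σ` makes `θ ∘ σ`
  -- preserve all fibres.
  obtain ⟨σ, hσ⟩ := Finite.surjective_of_injective hcomp SimpleGraph.Hom.id
  refine not_exists_hom_shadow_eq huv (θ.toHom.comp σ) fun z => ?_
  rw [← hΞ]
  exact congrArg CFIVertex.shadow (DFunLike.congr_fun hσ z)

end NotIsomorphic

/-! ### The base graph: the cylindrical hexagonal wall and its separators. -/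

section Wall

/-- The vertices of the cylindrical wall: `k + 1` rows, arranged cyclically, of length
`4 * k + 6`. -/
abbrev WallVertex (k : ℕ) : Type := Fin (4 * k + 6) × ZMod (k + 1)

/-- The cylindrical hexagonal wall: every row is a path, consecutive rows are joined by edges from
the odd positions to the next ones, and the first and the last positions form cycles. -/
def wall (k : ℕ) : SimpleGraph (WallVertex k) :=
  SimpleGraph.fromRel fun x y =>
    (y.1.val = x.1.val + 1 ∧ (x.2 = y.2 ∨ x.1.val % 2 = 1 ∧ x.2 = y.2 + 1)) ∨
      (x.1.val = y.1.val ∧ (x.1.val = 0 ∨ x.1.val = 4 * k + 5) ∧ y.2 = x.2 + 1)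

theorem zmod_natCast_ne_zero {k n : ℕ} (h0 : 0 < n) (hn : n ≤ k) : (n : ZMod (k + 1)) ≠ 0 := by
  rw [Ne, ZMod.natCast_eq_zero_iff]
  intro h
  have := Nat.le_of_dvd h0 h
  omega

theorem zmod_ne_zero {k : ℕ} (hk : 3 ≤ k) :
    (1 : ZMod (k + 1)) ≠ 0 ∧ (2 : ZMod (k + 1)) ≠ 0 ∧ (3 : ZMod (k + 1)) ≠ 0 := by
  refine ⟨?_, ?_, ?_⟩
  · exact_mod_cast zmod_natCast_ne_zero (n := 1) (by omega) (by omega)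
  · exact_mod_cast zmod_natCast_ne_zero (n := 2) (by omega) (by omega)
  · exact_mod_cast zmod_natCast_ne_zero (n := 3) (by omega) (by omega)

theorem wall_adj_iff {k : ℕ} (hk : 3 ≤ k) {p q : Fin (4 * k + 6)} {i j : ZMod (k + 1)} :
    (wall k).Adj (p, i) (q, j) ↔
      (q.val = p.val + 1 ∧ (i = j ∨ p.val % 2 = 1 ∧ i = j + 1)) ∨
      (p.val = q.val + 1 ∧ (i = j ∨ q.val % 2 = 1 ∧ j = i + 1)) ∨
      (p.val = q.val ∧ (p.val = 0 ∨ p.val = 4 * k + 5) ∧ (j = i + 1 ∨ i = j + 1)) := by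
  obtain ⟨h1, -, -⟩ := zmod_ne_zero hk
  have h2 : ∀ a : ZMod (k + 1), a ≠ a + 1 := fun a h => h1 (by simpa using h)
  simp only [wall, SimpleGraph.fromRel_adj, ne_eq, Prod.mk.injEq, Fin.ext_iff]
  constructor
  · grind
  · intro h
    refine ⟨?_, by grind⟩
    rintro ⟨h3, rfl⟩
    have := h2 i
    grind

theorem wall_neighbors {k : ℕ} (hk : 3 ≤ k) (x : WallVertex k) :
    ∃ a b c, a ≠ b ∧ a ≠ c ∧ b ≠ c ∧ ∀ y, (wall k).Adj x y ↔ y = a ∨ y = b ∨ y = c := by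
  obtain ⟨h1, h2, -⟩ := zmod_ne_zero hk
  obtain ⟨⟨p, hp⟩, i⟩ := x
  have e1 : i ≠ i + 1 := fun h => h1 (by linear_combination -h)
  have e2 : i ≠ i - 1 := fun h => h1 (by linear_combination h)
  have e3 : i + 1 ≠ i - 1 := fun h => h2 (by linear_combination h)
  by_cases hp0 : p = 0
  · subst hp0
    refine ⟨(⟨1, by omega⟩, i), (⟨0, hp⟩, i + 1), (⟨0, hp⟩, i - 1), ?_, ?_, ?_, ?_⟩
    · simp
    · simp
    · simpa using e3
    · rintro ⟨⟨q, hq⟩, j⟩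
      rw [wall_adj_iff hk]
      simp only [Prod.mk.injEq, Fin.mk.injEq]
      grind
  · by_cases hp1 : p = 4 * k + 5
    · subst hp1
      refine ⟨(⟨4 * k + 4, by omega⟩, i), (⟨4 * k + 5, hp⟩, i + 1), (⟨4 * k + 5, hp⟩, i - 1),
        ?_, ?_, ?_, ?_⟩
      · simp
      · simp
      · simpa using e3
      · rintro ⟨⟨q, hq⟩, j⟩
        rw [wall_adj_iff hk]
        simp only [Prod.mk.injEq, Fin.mk.injEq]
        grind
    · by_cases hp2 : p % 2 = 1
      · refine ⟨(⟨p - 1, by omega⟩, i), (⟨p + 1, by omega⟩, i), (⟨p + 1, by omega⟩, i - 1),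
          ?_, ?_, ?_, ?_⟩
        · simp only [ne_eq, Prod.mk.injEq, Fin.mk.injEq]
          omega
        · simp only [ne_eq, Prod.mk.injEq, Fin.mk.injEq]
          omega
        · simpa using e2
        · rintro ⟨⟨q, hq⟩, j⟩
          rw [wall_adj_iff hk]
          simp only [Prod.mk.injEq, Fin.mk.injEq]
          grind
      · refine ⟨(⟨p + 1, by omega⟩, i), (⟨p - 1, by omega⟩, i), (⟨p - 1, by omega⟩, i + 1),
          ?_, ?_, ?_, ?_⟩
        · simp only [ne_eq, Prod.mk.injEq, Fin.mk.injEq]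
          omega
        · simp only [ne_eq, Prod.mk.injEq, Fin.mk.injEq]
          omega
        · simpa using e1
        · rintro ⟨⟨q, hq⟩, j⟩
          rw [wall_adj_iff hk]
          simp only [Prod.mk.injEq, Fin.mk.injEq]
          grind

theorem wall_isRegularOfDegree {k : ℕ} (hk : 3 ≤ k) [DecidableRel (wall k).Adj] :
    (wall k).IsRegularOfDegree 3 := by
  intro x
  obtain ⟨a, b, c, hab, hac, hbc, h⟩ := wall_neighbors hk x
  rw [← SimpleGraph.card_neighborFinset_eq_degree, Finset.card_eq_three]
  refine ⟨a, b, c, hab, hac, hbc, ?_⟩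
  ext y
  simp [h]

theorem wall_exists_adj_ne {k : ℕ} (hk : 3 ≤ k) (x y : WallVertex k) :
    ∃ n, (wall k).Adj x n ∧ n ≠ y := by
  obtain ⟨a, b, c, hab, -, -, h⟩ := wall_neighbors hk x
  by_cases ha : a = y
  · exact ⟨b, (h b).2 (by simp), fun hb => hab (ha.trans hb.symm)⟩
  · exact ⟨a, (h a).2 (by simp), ha⟩

theorem zmod_not_triangle {k : ℕ} (hk : 3 ≤ k) {i j l : ZMod (k + 1)}
    (hij : j = i + 1 ∨ i = j + 1) (hjl : l = j + 1 ∨ j = l + 1) (hil : l = i + 1 ∨ i = l + 1) :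
    False := by
  obtain ⟨h1, -, h3⟩ := zmod_ne_zero hk
  rcases hij with h | h <;> rcases hjl with h' | h' <;> rcases hil with h'' | h''
  · exact h1 (by linear_combination h'' - h - h')
  · exact h3 (by linear_combination - h - h' - h'')
  · exact h1 (by linear_combination h - h' - h'')
  · exact h1 (by linear_combination -h + h' - h'')
  · exact h1 (by linear_combination h' - h - h'')
  · exact h1 (by linear_combination h - h' - h'')
  · exact h3 (by linear_combination -h - h' - h'')
  · exact h1 (by linear_combination h'' - h - h')

/-- A triangle would have to lie in one of the two end cycles, whose length `k + 1` is at least 4.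
-/
theorem wall_triangleFree {k : ℕ} (hk : 3 ≤ k) (x y z : WallVertex k)
    (hxy : (wall k).Adj x y) (hyz : (wall k).Adj y z) : ¬ (wall k).Adj x z := by
  obtain ⟨h1, -, -⟩ := zmod_ne_zero hk
  have h2 : ∀ a : ZMod (k + 1), a ≠ a + 1 := fun a h => h1 (by simpa using h)
  obtain ⟨p, i⟩ := x
  obtain ⟨q, j⟩ := y
  obtain ⟨r, l⟩ := z
  rw [wall_adj_iff hk] at hxy hyz ⊢
  have hi := h2 i
  have hj := h2 j
  have hl := h2 l
  intro hxz
  rcases hxy with ⟨e1, e2⟩ | ⟨e1, e2⟩ | ⟨e1, e2, e3⟩ <;>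
    rcases hyz with ⟨f1, f2⟩ | ⟨f1, f2⟩ | ⟨f1, f2, f3⟩ <;>
    rcases hxz with ⟨g1, g2⟩ | ⟨g1, g2⟩ | ⟨g1, g2, g3⟩ <;>
    first
      | omega
      | exact zmod_not_triangle hk e3 f3 g3
      | grind

/-- The column of a position: the positions `2 c - 1` and `2 c` form the column `c`. -/
def column {k : ℕ} (p : Fin (4 * k + 6)) : Fin (2 * k + 4) := ⟨(p.val + 1) / 2, by omega⟩

section Connectivity

variable {k : ℕ} {A : Set (WallVertex k)}

/-- Both vertices lie in `A` and they are connected inside `A`. -/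
def ReachableIn (A : Set (WallVertex k)) (x y : WallVertex k) : Prop :=
  ∃ (hx : x ∈ A) (hy : y ∈ A), ((wall k).induce A).Reachable ⟨x, hx⟩ ⟨y, hy⟩

theorem ReachableIn.trans {x y z : WallVertex k} (h : ReachableIn A x y)
    (h' : ReachableIn A y z) : ReachableIn A x z := by
  obtain ⟨hx, hy, h⟩ := h
  obtain ⟨_, hz, h'⟩ := h'
  exact ⟨hx, hz, h.trans h'⟩

theorem ReachableIn.symm {x y : WallVertex k} (h : ReachableIn A x y) : ReachableIn A y x := by
  obtain ⟨hx, hy, h⟩ := h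
  exact ⟨hy, hx, h.symm⟩

theorem ReachableIn.of_adj {x y : WallVertex k} (hx : x ∈ A) (hy : y ∈ A)
    (h : (wall k).Adj x y) : ReachableIn A x y :=
  ⟨hx, hy, SimpleGraph.Adj.reachable (by exact h)⟩

theorem reachableIn_row (hk : 3 ≤ k) {i : ZMod (k + 1)} (hA : ∀ p, (p, i) ∈ A)
    (p q : Fin (4 * k + 6)) : ReachableIn A (p, i) (q, i) := by
  have h0 : ∀ n (hn : n < 4 * k + 6), ReachableIn A (⟨n, hn⟩, i) (⟨0, by omega⟩, i) := by
    intro n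
    induction n with
    | zero => exact fun hn => ⟨hA _, hA _, SimpleGraph.Reachable.refl _⟩
    | succ n ih =>
      intro hn
      refine ReachableIn.trans (.of_adj (hA _) (hA _) ?_) (ih (by omega))
      rw [wall_adj_iff hk]
      simp
  exact (h0 p.1 p.2).trans (h0 q.1 q.2).symm

/-- Inner columns are zigzag cycles: for odd `p`, the vertex `(p + 1, i)` is adjacent to both `(p,
i)` and `(p, i + 1)`. The two outermost columns are the end cycles. -/
theorem reachableIn_column (hk : 3 ≤ k) {c : Fin (2 * k + 4)}
    (hA : ∀ p i, column p = c → (p, i) ∈ A) (p : Fin (4 * k + 6)) (hp : column p = c)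
    (i j : ZMod (k + 1)) : ReachableIn A (p, i) (p, j) := by
  have hstep : ∀ i, ReachableIn A (p, i) (p, i + 1) := by
    intro i
    obtain ⟨p, hp'⟩ := p
    by_cases h : p = 0 ∨ p = 4 * k + 5
    · refine .of_adj (hA _ _ hp) (hA _ _ hp) ?_
      rw [wall_adj_iff hk]
      simp [h]
    · by_cases h2 : p % 2 = 1
      · have hq : column (⟨p + 1, by omega⟩ : Fin (4 * k + 6)) = c := by
          rw [← hp]
          simp only [column, Fin.mk.injEq]
          omega
        refine ReachableIn.trans (y := (⟨p + 1, by omega⟩, i))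
          (.of_adj (hA _ _ hp) (hA _ _ hq) ?_) (.of_adj (hA _ _ hq) (hA _ _ hp) ?_)
        · rw [wall_adj_iff hk]
          simp
        · rw [wall_adj_iff hk]
          simp [h2]
      · have hq : column (⟨p - 1, by omega⟩ : Fin (4 * k + 6)) = c := by
          rw [← hp]
          simp only [column, Fin.mk.injEq]
          omega
        refine ReachableIn.trans (y := (⟨p - 1, by omega⟩, i + 1))
          (.of_adj (hA _ _ hp) (hA _ _ hq) ?_) (.of_adj (hA _ _ hq) (hA _ _ hp) ?_)
        · rw [wall_adj_iff hk]
          right; left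
          exact ⟨by simp only; omega, Or.inr ⟨by simp only; omega, rfl⟩⟩
        · rw [wall_adj_iff hk]
          left
          exact ⟨by simp only; omega, Or.inl rfl⟩
  have hn : ∀ n : ℕ, ReachableIn A (p, i) (p, i + n) := by
    intro n
    induction n with
    | zero => rw [Nat.cast_zero, add_zero]; exact ⟨hA _ _ hp, hA _ _ hp, .refl _⟩
    | succ n ih =>
      rw [Nat.cast_succ, ← add_assoc]
      exact ih.trans (hstep _)
  have := hn (j - i).val
  rwa [ZMod.natCast_zmod_val, add_sub_cancel] at this

end Connectivity

theorem wall_connected {k : ℕ} (hk : 3 ≤ k) : (wall k).Connected := by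
  have h : ∀ x y, ReachableIn (k := k) Set.univ x y := fun x y =>
    (reachableIn_row hk (fun _ => Set.mem_univ _) x.1 y.1).trans
      (reachableIn_column hk (c := column y.1) (fun _ _ _ => Set.mem_univ _) y.1 rfl x.2 y.2)
  refine SimpleGraph.connected_iff_exists_forall_reachable _ |>.2 ⟨(0, 0), fun y => ?_⟩
  obtain ⟨_, _, h⟩ := h (0, 0) y
  exact h.map (SimpleGraph.Embedding.induce Set.univ).toHom

theorem card_wallVertex (k : ℕ) : Fintype.card (WallVertex k) = (4 * k + 6) * (k + 1) := by
  rw [Fintype.card_prod, Fintype.card_fin, ZMod.card]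

/-- Some row and some column avoid `S`. All untouched rows and columns then lie in one component,
which misses at most the `2 * k * k` vertices in a hit row and a hit column, less than half of the
wall. -/
theorem not_isSeparator_wall {k : ℕ} (hk : 3 ≤ k) {S : Finset (WallVertex k)}
    (hS : S.card ≤ k) : ¬ IsSeparator (wall k) S := by
  intro hsep
  let I := S.image Prod.snd
  let C := S.image fun x => column x.1
  have hI : I.card ≤ k := Finset.card_image_le.trans hS
  have hC : C.card ≤ k := Finset.card_image_le.trans hS
  have hrow : ∀ i ∉ I, ∀ p, (p, i) ∈ ((S : Set (WallVertex k))ᶜ) :=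
    fun i hi p h => hi (Finset.mem_image.2 ⟨(p, i), h, rfl⟩)
  have hcol : ∀ c ∉ C, ∀ p i, column p = c → (p, i) ∈ ((S : Set (WallVertex k))ᶜ) :=
    fun c hc p i hp h => hc (Finset.mem_image.2 ⟨(p, i), h, hp⟩)
  obtain ⟨i₀, hi₀⟩ : ∃ i, i ∉ I := by
    by_contra! h
    have := Finset.card_le_card (fun i _ => h i : Finset.univ ⊆ I)
    rw [Finset.card_univ, ZMod.card] at this
    omega
  obtain ⟨c₀, hc₀⟩ : ∃ c, c ∉ C := by
    by_contra! h
    have := Finset.card_le_card (fun i _ => h i : Finset.univ ⊆ C)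
    rw [Finset.card_univ, Fintype.card_fin] at this
    omega
  -- For `c₀ = 0` the truncated subtraction gives position 0, the only one in that column.
  have hp₀ : ∃ p : Fin (4 * k + 6), column p = c₀ :=
    ⟨⟨2 * c₀.val - 1, by omega⟩, by
      apply Fin.ext
      simp only [column]
      omega⟩
  obtain ⟨p₀, hp₀⟩ := hp₀
  have hreach : ∀ x : WallVertex k, x.2 ∉ I ∨ column x.1 ∉ C →
      ReachableIn ((S : Set (WallVertex k))ᶜ) x (p₀, i₀) := by
    rintro ⟨p, i⟩ (h | h)
    · exact (reachableIn_row hk (hrow i h) p p₀).trans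
        (reachableIn_column hk (hcol c₀ hc₀) p₀ hp₀ i i₀)
    · exact (reachableIn_column hk (hcol _ h) p rfl i i₀).trans
        (reachableIn_row hk (hrow i₀ hi₀) p p₀)
  let K := ((wall k).induce ((S : Set (WallVertex k))ᶜ)).connectedComponentMk
    ⟨(p₀, i₀), hrow i₀ hi₀ p₀⟩
  have hK := hsep K
  let bad : Finset (WallVertex k) := {x | x.2 ∈ I ∧ column x.1 ∈ C}
  have hbad : bad.card ≤ 2 * (k * k) := by
    -- A position is recovered from its column and its parity; the minimum only keeps the value in
    -- range for the last column.
    have h1 : bad ⊆ (C ×ˢ I ×ˢ (Finset.univ : Finset (Fin 2))).image fun y =>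
        (⟨min (2 * y.1.val - y.2.2.val) (4 * k + 5), by omega⟩, y.2.1) := by
      intro x hx
      simp only [bad, Finset.mem_filter, Finset.mem_univ, true_and] at hx
      refine Finset.mem_image.2 ⟨(column x.1, x.2, ⟨x.1.val % 2, by omega⟩), ?_, ?_⟩
      · simp [hx]
      · refine Prod.ext (Fin.ext ?_) rfl
        simp only [column]
        omega
    refine (Finset.card_le_card h1).trans (Finset.card_image_le.trans ?_)
    rw [Finset.card_product, Finset.card_product, Finset.card_univ, Fintype.card_fin]
    nlinarith [Nat.mul_le_mul hC hI]
  have hsub : ((badᶜ : Finset (WallVertex k)) : Set (WallVertex k)) ⊆ Subtype.val '' K.supp := by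
    intro x hx
    have hx' : x.2 ∉ I ∨ column x.1 ∉ C := by
      simp only [bad, Finset.coe_compl, Finset.coe_filter, Set.mem_compl_iff, Set.mem_ofPred_eq,
        Finset.mem_univ, true_and] at hx
      tauto
    obtain ⟨h1, h2, h⟩ := hreach x hx'
    exact ⟨⟨x, h1⟩, SimpleGraph.ConnectedComponent.sound h, rfl⟩
  have hle := Set.ncard_le_ncard hsub (Set.toFinite _)
  rw [Set.ncard_coe_finset, Set.ncard_image_of_injective _ Subtype.val_injective,
    Finset.card_compl] at hle
  rw [card_wallVertex] at hK hle
  have : (4 * k + 6) * (k + 1) = 4 * (k * k) + 10 * k + 6 := by ring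
  omega

theorem isSeparator_wall {k : ℕ} (hk : 3 ≤ k) :
    ∃ S : Finset (WallVertex k), IsSeparator (wall k) S ∧ S.card = k + 1 := by
  have hcard : ∀ P : Finset (Fin (4 * k + 6)),
      (P ×ˢ (Finset.univ : Finset (ZMod (k + 1)))).card = P.card * (k + 1) := by
    intro P
    rw [Finset.card_product, Finset.card_univ, ZMod.card]
  -- Removing position `m` from all rows leaves `2 * k + 2` positions on the left and `2 * k + 3`,
  -- exactly half of them, on the right.
  let m : Fin (4 * k + 6) := ⟨2 * k + 2, by omega⟩
  refine ⟨{m} ×ˢ Finset.univ, ?_, by rw [hcard]; simp⟩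
  intro K
  have hside : ∀ P : Finset (Fin (4 * k + 6)), P.card ≤ 2 * k + 3 →
      (∃ x ∈ K.supp, x.1.1 ∈ P) → (∀ p ∈ P, ∀ q, q.val ≤ p.val + 1 → p.val ≤ q.val + 1 →
        q ≠ m → q ∈ P) → 2 * K.supp.ncard ≤ Fintype.card (WallVertex k) := by
    rintro P hP ⟨x, hx, hxP⟩ hclosed
    have hsub : Subtype.val '' K.supp ⊆
        ((P ×ˢ (Finset.univ : Finset (ZMod (k + 1))) : Finset (WallVertex k)) :
          Set (WallVertex k)) := by
      rintro _ ⟨y, hy, rfl⟩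
      obtain ⟨w⟩ := SimpleGraph.ConnectedComponent.exact (hx.trans hy.symm)
      suffices y.1.1 ∈ P by simpa using this
      clear hx hy
      induction w with
      | nil => exact hxP
      | @cons a b c hab w ih =>
        refine ih (hclosed a.1.1 hxP b.1.1 ?_ ?_ fun h => b.2 (Finset.mem_coe.2 (Finset.mem_product.2
          ⟨by simp [h], Finset.mem_univ _⟩)))
        all_goals
          have h : (wall k).Adj (a.1.1, a.1.2) (b.1.1, b.1.2) := hab
          rw [wall_adj_iff hk] at h
          omega
    have hle := Set.ncard_le_ncard hsub (Set.toFinite _)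
    rw [Set.ncard_coe_finset, hcard, Set.ncard_image_of_injective _ Subtype.val_injective] at hle
    rw [card_wallVertex]
    have := Nat.mul_le_mul_right (k + 1) hP
    have h2 : (4 * k + 6) * (k + 1) = 2 * ((2 * k + 3) * (k + 1)) := by ring
    omega
  obtain ⟨x, hx⟩ := K.nonempty_supp
  have hxm : x.1.1 ≠ m := fun h => x.2 (Finset.mem_coe.2 (Finset.mem_product.2
    ⟨by simp [h], Finset.mem_univ _⟩))
  rcases lt_or_gt_of_ne hxm with h | h
  · refine hside (Finset.Iio m) (by rw [Fin.card_Iio]; simp [m]) ⟨x, hx, by simpa using h⟩ ?_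
    intro p hp q h1 h2 hq
    simp only [Finset.mem_Iio, Fin.lt_def, ne_eq, Fin.ext_iff] at *
    omega
  · refine hside (Finset.Ioi m) (by rw [Fin.card_Ioi]; simp only [m]; omega)
      ⟨x, hx, by simpa using h⟩ ?_
    intro p hp q h1 h2 hq
    simp only [Finset.mem_Ioi, Fin.lt_def, ne_eq, Fin.ext_iff] at *
    omega

theorem hasSeparatorSize_wall {k : ℕ} (hk : 3 ≤ k) : HasSeparatorSize (wall k) (k + 1) := by
  refine ⟨isSeparator_wall hk, ?_⟩
  rintro n ⟨S, hS, rfl⟩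
  by_contra h
  exact not_isSeparator_wall hk (by omega) hS

end Wall

end SubgraphWL

theorem theorem4 (k : ℕ) (hk : 3 ≤ k) :
    ∃ (V : Type) (_ : Fintype V) (_ : DecidableEq V) (G : SimpleGraph V) (_ : DecidableRel G.Adj)
      (u v : V),
      G.Connected ∧ G.IsRegularOfDegree 3 ∧ SubgraphWL.HasSeparatorSize G (k + 1) ∧ G.Adj u v ∧
      IsEmpty (SubgraphWL.CFI G ∅ ≃g SubgraphWL.CFI G {s(u, v)}) ∧
      ¬ SubgraphWL.KWLDistinguishes k (SubgraphWL.CFI G ∅) (SubgraphWL.CFI G {s(u, v)}) ∧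
      ∀ t : ℕ, t ≤ 4 →
        (∀ x : SubgraphWL.CFIVertex G,
          (SubgraphWL.egonet (SubgraphWL.CFI G ∅) (fun _ => ()) t x).Iso
            (SubgraphWL.egonet (SubgraphWL.CFI G {s(u, v)}) (fun _ => ()) t x)) ∧
        ∀ (C : Type*) (c₀ : C) (HASH : SubgraphWL.RootedGraph C → C), SubgraphWL.IsHash HASH →
          ¬ SubgraphWL.Subgraph1WLDistinguishes HASH c₀ t
            (SubgraphWL.CFI G ∅) (SubgraphWL.CFI G {s(u, v)}) := by
  have huv : (SubgraphWL.wall k).Adj (⟨0, by omega⟩, 0) (⟨1, by omega⟩, 0) := by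
    rw [SubgraphWL.wall_adj_iff hk]
    simp
  have htw := SubgraphWL.isTwisting_single huv
  have hdeg := SubgraphWL.wall_exists_adj_ne hk
  have htri := SubgraphWL.wall_triangleFree hk
  classical
  refine ⟨SubgraphWL.WallVertex k, inferInstance, inferInstance, SubgraphWL.wall k, inferInstance,
    _, _, SubgraphWL.wall_connected hk, SubgraphWL.wall_isRegularOfDegree hk,
    SubgraphWL.hasSeparatorSize_wall hk, huv, SubgraphWL.isEmpty_CFI_iso huv,
    SubgraphWL.not_kWLDistinguishes_CFI (fun _ hS => SubgraphWL.not_isSeparator_wall hk hS)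
      (SubgraphWL.wall_connected hk) huv, fun t ht => ⟨fun x => ?_, ?_⟩⟩
  · exact SubgraphWL.egonet_CFI_iso htw hdeg htri ht rfl fun _ _ _ => rfl
  · rintro C c₀ HASH hH ⟨l, hl⟩
    exact hl (Multiset.map_congr rfl fun z _ =>
      SubgraphWL.subgraphColor_CFI_eq htw hdeg htri c₀ hH ht l z z rfl)
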